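/- Regard $\mathbb{C}$ as a first-order structure in the language of rings, and let $\mathrm{acl}(B)$ denote the model-theoretic algebraic closure of a set $B$, i.e. the union of all finite sets definable with parameters from $B$ (in particular $\mathrm{acl}(\emptyset)$ is the field of algebraic numbers). For a set $X$ defined by a formula $\Phi$ with parameters from $B\subseteq\mathbb{C}$, the dimension of $X$ is the largest $d$ for which there are an elementary extension $M$ of $\mathbb{C}$, a tuple $(a_1,\dots,a_m)$ of elements of $M$ satisfying $\Phi$, and a subtuple $(a_{i_1},\dots,a_{i_d})$ such that $a_{i_{j+1}}\notin\mathrm{acl}(B\cup\{a_{i_1},\dots,a_{i_j}\})$ for all $0\le j<d$ (the dimension of the empty set is $-\infty$). A $\mathbb{C}$-definable $k$-curve is a subset of $\mathbb{C}^k$ that is definable with parameters from $\mathbb{C}$ and has dimension at most $1$. A cylinder in $\mathbb{C}^m$ based on a $k$-curve $C$ is a set of the form $\{(x_1,\dots,x_m)\in\mathbb{C}^m : (x_{i_1},\dots,x_{i_k})\in C\}$ with $1\le i_1<\dots<i_k\le m$. For every natural number $n\ge 2$ there is a subset of $\mathbb{C}^{n+1}$ that is definable with parameters from $\mathrm{acl}(\emptyset)$,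 has dimension exactly $1$, and is not a boolean combination of cylinders in $\mathbb{C}^{n+1}$ whose bases are $\mathbb{C}$-definable $k$-curves with $k\le\max\{2,n-1\}$ (different cylinders may have different $k$ and different indices). -/

import Mathlib

namespace CurveCylinders

open FirstOrder FirstOrder.Language

universe u v w

/-- The model-theoretic algebraic closure of a set `A` in an `L`-structure `M`: the union of all
finite subsets of `M` which are definable in `M` with parameters from `A`. -/
def acl (L : FirstOrder.Language.{u, v}) {M : Type w} [L.Structure M] (A : Set M) : Set M :=
  {b | ∃ D : Set M, A.Definable₁ L D ∧ D.Finite ∧ b ∈ D}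

/-- `HasIndependentSubtuple L B X d`: there are a formula `φ` with parameters from `B` which defines
`X` in `M`, an elementary extension `f : M → N`, a tuple `a` of elements of `N` satisfying `φ`
in `N`, and a subtuple `a (i 0), …, a (i (d - 1))` of length `d`, none of whose entries is
algebraic over `B` and the preceding entries. In a formula `φ : L.Formula (B ⊕ Fin n)` the variables
in `B` stand for the parameters. (Every elementary extension, restricted to the finitely many
elements at hand, is realized in a saturated one, so that nothing changes when `N` is required
to be a saturated extension.) -/
def HasIndependentSubtuple (L : FirstOrder.Language.{u, v}) {M : Type w} [L.Structure M] (B : Set M) {n : ℕ}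
    (X : Set (Fin n → M)) (d : ℕ) : Prop :=
  ∃ φ : L.Formula (B ⊕ Fin n),
    X = {x | φ.Realize (Sum.elim (fun b : B => (b : M)) x)} ∧
    ∃ (N : Type (max u v w)) (_ : L.Structure N) (f : M ↪ₑ[L] N) (a : Fin n → N),
      φ.Realize (Sum.elim (fun b : B => f (b : M)) a) ∧
      ∃ i : Fin d ↪o Fin n, ∀ j : Fin d,
        a (i j) ∉ acl L (f '' B ∪ (fun k => a (i k)) '' {k | k < j})

/-- The `acl`-dimension of a set `X ⊆ M ^ n` that is definable with parameters from `B`: the largest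
length of an independent subtuple of a tuple of `X` in an elementary extension; it is `⊥`
(that is, `-∞`) for the empty set. Only used for `B`-definable sets `X`. -/
noncomputable def aclDim (L : FirstOrder.Language.{u, v}) {M : Type w} [L.Structure M] (B : Set M) {n : ℕ}
    (X : Set (Fin n → M)) : WithBot ℕ∞ :=
  ⨆ (d : ℕ) (_ : HasIndependentSubtuple L B X d), ((d : ℕ∞) : WithBot ℕ∞)

/-- `A`-definable `n`-curves: subsets of `M ^ n` of dimension at most one that are definable with
parameters from `A`. -/
def IsCurve (L : FirstOrder.Language.{u, v}) {M : Type w} [L.Structure M] (A : Set M) {n : ℕ}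
    (C : Set (Fin n → M)) : Prop :=
  A.Definable L C ∧ aclDim L A C ≤ 1

/-- `A`-definable cylinders in `M ^ m` based on a `k`-curve. -/
def IsCylinderOnCurve (L : FirstOrder.Language.{u, v}) {M : Type w} [L.Structure M] (A : Set M) {m : ℕ}
    (k : ℕ) (Z : Set (Fin m → M)) : Prop :=
  ∃ (i : Fin k ↪o Fin m) (C : Set (Fin k → M)),
    IsCurve L A C ∧ Z = {x | (fun j => x (i j)) ∈ C}

/-- The field `ℂ` as a first-order structure in the language of rings. -/
noncomputable instance complexRingStructure : FirstOrder.Ring.CompatibleRing ℂ :=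
  FirstOrder.Ring.compatibleRingOfRing ℂ

end CurveCylinders

/-! The witness is the curve `x_i ^ 2 = t - i` for `i < n`, with last coordinate `x_n = x_0 ⋯
x_(n-1)`. Take `t` transcendental over a given finite set of parameters and replace `x_n` by `-x_n`:
the point leaves the curve, but no proper subtuple notices. If `x_n` is omitted, nothing has
changed; if `x_j` is omitted, an automorphism flipping the sign of `x_j` alone carries the other
coordinates to the new ones (`exists_properSubtuplesConjugate_squareRootsCurve`). Definable sets are
invariant under automorphisms fixing their parameters, so neither a cylinder ignoring some
coordinate nor a boolean combination of such cylinders separates the two points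
(`exists_finset_forall_mem_iff_of_mem_closure`).

The sign flips exist by Kummer theory (`exists_algEquiv_neg_of_transcendental`): nonempty products
of distinct `t - c_i` are not squares. The dimension is one because a single square root determines
`t`, hence every coordinate up to sign. -/

namespace CurveCylinders

/-! ### Translating a transcendental element by an automorphism -/

open IntermediateField in
/-- A transcendental element `t` is part of a transcendence basis; removing `t` from it gives a
field over which `t` is transcendental and generates a field below which everything is algebraic. -/
theorem exists_transcendental_and_isAlgebraic_adjoin {K E : Type*} [Field K] [Field E]
    [Algebra K E] {t : E} (ht : Transcendental K t) :
    ∃ F : IntermediateField K E, Transcendental F t ∧ Algebra.IsAlgebraic F⟮t⟯ E := by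
  have hind : AlgebraicIndepOn K id ({t} : Set E) :=
    (algebraicIndependent_singleton_iff (⟨t, rfl⟩ : ({t} : Set E))).2 ht
  obtain ⟨T, htT, hT⟩ := exists_isTranscendenceBasis_superset hind
  have htT' : t ∈ T := htT rfl
  refine ⟨adjoin K (T \ {t}), ?_, ?_⟩
  · rw [IntermediateField.transcendental_adjoin_iff]
    have := hT.1.transcendental_adjoin (s := {x : T | (x : E) ≠ t}) (i := ⟨t, htT'⟩) (by simp)
    have e : ((↑) '' {x : T | (x : E) ≠ t} : Set E) = T \ {t} := by
      ext x
      simp [and_comm]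
    rw [e] at this
    exact this
  · have h := hT.isAlgebraic_field
    have e : adjoin K (Set.range ((↑) : T → E)) =
        (adjoin (adjoin K (T \ {t})) {t}).restrictScalars K := by
      rw [adjoin_adjoin_left, Subtype.range_coe, Set.sdiff_union_of_subset htT]
    rw [e] at h
    exact h

open IntermediateField in
-- `t` and `t + c` are both transcendental and generate the same field, so the substitution `t ↦ t +
-- c` extends to the algebraic closure `E`.
theorem exists_algEquiv_add_of_isAlgebraic_adjoin {F E : Type*} [Field F] [Field E] [IsAlgClosed E]
    [Algebra F E] {t : E} (htF : Transcendental F t) [halg : Algebra.IsAlgebraic F⟮t⟯ E] (c : F) :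
    ∃ σ : E ≃ₐ[F] E, σ t = t + algebraMap F E c := by
  obtain ⟨u, hu⟩ : ∃ u : E, u = t + algebraMap F E c := ⟨_, rfl⟩
  have htu : t = u - algebraMap F E c := by rw [hu]; ring
  have huF : Transcendental F u := by
    intro h
    apply htF
    rw [htu]
    exact h.sub (isAlgebraic_algebraMap _)
  have hFu : F⟮t⟯ = F⟮u⟯ := by
    apply le_antisymm
    · rw [adjoin_simple_le_iff, htu]
      exact sub_mem (mem_adjoin_simple_self _ _) (IntermediateField.algebraMap_mem _ _)
    · rw [adjoin_simple_le_iff, hu]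
      exact add_mem (mem_adjoin_simple_self _ _) (IntermediateField.algebraMap_mem _ _)
  have halg' : Algebra.IsAlgebraic F⟮u⟯ E := hFu ▸ halg
  have : IsAlgClosure F⟮t⟯ E := ⟨inferInstance, halg⟩
  have : IsAlgClosure F⟮u⟯ E := ⟨inferInstance, halg'⟩
  let e : F⟮t⟯ ≃ₐ[F] F⟮u⟯ := (RatFunc.algEquivOfTranscendental t htF).symm.trans
    (RatFunc.algEquivOfTranscendental u huF)
  have het : e (AdjoinSimple.gen F t) = AdjoinSimple.gen F u := by
    apply Subtype.ext
    simp [e]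
  let σ : E ≃+* E := IsAlgClosure.equivOfEquiv E E e.toRingEquiv
  have hσ (x : F⟮t⟯) : σ (algebraMap F⟮t⟯ E x) = algebraMap F⟮u⟯ E (e x) :=
    IsAlgClosure.equivOfEquiv_algebraMap E E e.toRingEquiv x
  refine ⟨AlgEquiv.ofRingEquiv (f := σ) fun x ↦ ?_, ?_⟩
  · have := hσ (algebraMap F F⟮t⟯ x)
    rw [e.commutes] at this
    exact this
  · have := hσ (AdjoinSimple.gen F t)
    rw [het] at this
    exact this.trans hu

/-- Over an algebraically closed field, a transcendental element is conjugate to all its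
translates. -/
theorem exists_algEquiv_add_of_transcendental {K E : Type*} [Field K] [Field E] [IsAlgClosed E]
    [Algebra K E] {t : E} (ht : Transcendental K t) (c : K) :
    ∃ σ : E ≃ₐ[K] E, σ t = t + algebraMap K E c := by
  obtain ⟨F, htF, halg⟩ := exists_transcendental_and_isAlgebraic_adjoin ht
  obtain ⟨σ, hσ⟩ := exists_algEquiv_add_of_isAlgebraic_adjoin htF (algebraMap K F c)
  exact ⟨σ.restrictScalars K, hσ⟩

/-- A field of uncountable cardinality has elements transcendental over any finitely generated
subfield. -/
theorem exists_transcendental_subfieldClosure {E : Type*} [Field E] [Uncountable E] {A : Set E}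
    (hA : A.Countable) : ∃ t : E, Transcendental (Subfield.closure A) t := by
  by_contra! h
  have halg : Algebra.IsAlgebraic (Subfield.closure A) E :=
    ⟨fun x ↦ by simpa [Transcendental] using h x⟩
  have h1 := Algebra.IsAlgebraic.cardinalMk_le_max (Subfield.closure A) E
  have h2 := Subfield.cardinalMk_closure_le_max A
  have h3 : Cardinal.mk A ≤ Cardinal.aleph0 := Cardinal.mk_le_aleph0_iff.2 hA.to_subtype
  have h4 : Cardinal.mk E ≤ Cardinal.aleph0 := by
    refine h1.trans (max_le (h2.trans (max_le h3 le_rfl)) le_rfl)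
  exact not_countable (α := E) (Cardinal.mk_le_aleph0_iff.1 h4)

/-! ### Sign changes in multiquadratic extensions -/

open IntermediateField in
theorem exists_eq_add_mul_of_mem_adjoin_simple {K E : Type*} [Field K] [Field E] [Algebra K E]
    {a y : E} {b : K} (ha : a ^ 2 = algebraMap K E b) (hy : y ∈ K⟮a⟯) :
    ∃ u v : K, y = algebraMap K E u + algebraMap K E v * a := by
  have hint : IsIntegral K a := by
    refine IsIntegral.of_pow (n := 2) two_pos ?_
    rw [ha]
    exact isIntegral_algebraMap
  rw [← mem_toSubalgebra, adjoin_simple_toSubalgebra_of_isAlgebraic hint.isAlgebraic] at hy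
  induction hy using Algebra.adjoin_induction with
  | mem x hx => exact ⟨0, 1, by simpa using hx⟩
  | algebraMap r => exact ⟨r, 0, by simp⟩
  | add x y _ _ hx hy =>
    obtain ⟨u, v, rfl⟩ := hx
    obtain ⟨u', v', rfl⟩ := hy
    exact ⟨u + u', v + v', by simp only [map_add]; ring⟩
  | mul x y _ _ hx hy =>
    obtain ⟨u, v, rfl⟩ := hx
    obtain ⟨u', v', rfl⟩ := hy
    refine ⟨u * u' + v * v' * b, u * v' + v * u', ?_⟩
    simp only [map_add, map_mul, ← ha]
    ring

open IntermediateField in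
/-- An element of the base field which becomes a square in a multiquadratic extension is a square
up to a product of some of the adjoined radicands. -/
theorem exists_isSquare_mul_prod_of_mem_adjoin {K E ι : Type*} [Field K] [Field E] [Algebra K E]
    [NeZero (2 : E)] {a : ι → E} {b : ι → K} (hab : ∀ i, a i ^ 2 = algebraMap K E (b i))
    (s : Finset ι) (c : K) (y : E) (hy : y ∈ adjoin K (a '' s)) (hyc : y ^ 2 = algebraMap K E c) :
    ∃ s' ⊆ s, IsSquare (c * ∏ i ∈ s', b i) := by
  classical
  induction s using Finset.induction_on generalizing c y with
  | empty =>
    simp only [Finset.coe_empty, Set.image_empty, adjoin_empty, mem_bot] at hy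
    obtain ⟨z, rfl⟩ := hy
    refine ⟨∅, subset_rfl, z, ?_⟩
    apply (algebraMap K E).injective
    simp [← hyc, sq]
  | insert i s his ih =>
    set L := adjoin K (a '' s) with hL
    have hyL : y ∈ adjoin L {a i} := by
      have : y ∈ (adjoin L {a i}).restrictScalars K := by
        rw [adjoin_adjoin_left]
        convert hy using 2
        rw [Finset.coe_insert, Set.image_insert_eq, Set.union_singleton]
      exact this
    obtain ⟨u, v, hyuv⟩ := exists_eq_add_mul_of_mem_adjoin_simple (K := L)
      (b := algebraMap K L (b i)) (hab i) hyL
    have hsub : s ⊆ insert i s := Finset.subset_insert i s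
    by_cases hyL' : y ∈ L
    · obtain ⟨s', hs', h⟩ := ih c y hyL' hyc
      exact ⟨s', hs'.trans hsub, h⟩
    have hv : v ≠ 0 := by
      rintro rfl
      apply hyL'
      rw [hyuv]
      simp
    -- Squaring `y = u + v * a i` gives `c = u ^ 2 + v ^ 2 * b i + 2 * u * v * a i`; if `u * v ≠ 0`,
    -- this puts `a i`, hence `y`, in `L`.
    have hu : u = 0 := by
      by_contra hu
      apply hyL'
      have hai : a i = algebraMap L E
          ((algebraMap K L c - u ^ 2 - v ^ 2 * algebraMap K L (b i)) / (2 * u * v)) := by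
        have h2 : (2 : E) ≠ 0 := NeZero.ne _
        simp only [map_div₀, map_sub, map_mul, map_pow, map_ofNat,
          ← IsScalarTower.algebraMap_apply, ← hyc, ← hab]
        rw [eq_div_iff (by simp [hu, hv, h2]), hyuv]
        ring
      rw [hyuv, hai]
      exact add_mem (SetLike.coe_mem u) (mul_mem (SetLike.coe_mem v)
        (Subtype.prop (_ / _ : L)))
    subst hu
    -- Now `y = v * a i`, so `y * a i = v * b i` lies in `L` and has square `c * b i`.
    obtain ⟨s', hs', h⟩ := ih (c * b i) (algebraMap L E v * algebraMap K E (b i))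
      (mul_mem (SetLike.coe_mem v) (IntermediateField.algebraMap_mem _ _)) (by
        rw [map_mul, ← hyc, hyuv, ← hab]
        simp only [map_zero, zero_add]
        ring)
    refine ⟨insert i s', Finset.insert_subset_insert i hs', ?_⟩
    rwa [Finset.prod_insert fun hi ↦ his (hs' hi), ← mul_assoc]

open IntermediateField in
/-- If the radicands `b i` are independent modulo squares then the sign of each square root
`a i` can be flipped by an automorphism which fixes all the others. -/
theorem exists_algEquiv_neg_of_not_isSquare_prod {K E ι : Type*} [Field K] [Field E] [CharZero E]
    [CharZero K]
    [IsAlgClosed E] [Algebra K E] [Algebra.IsAlgebraic K E] [Fintype ι] {a : ι → E} {b : ι → K}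
    (hab : ∀ i, a i ^ 2 = algebraMap K E (b i))
    (hb : ∀ s : Finset ι, s.Nonempty → ¬ IsSquare (∏ i ∈ s, b i)) (j : ι) :
    ∃ σ : E ≃ₐ[K] E, σ (a j) = -a j ∧ ∀ i ≠ j, σ (a i) = a i := by
  classical
  set L := adjoin K (a '' (Finset.univ.erase j : Finset ι)) with hL
  have hj : a j ∉ L := by
    intro h
    obtain ⟨s, hs, h⟩ := exists_isSquare_mul_prod_of_mem_adjoin hab _ (b j) _ h (hab j)
    have hjs : j ∉ s := fun hj ↦ by simpa using hs hj
    rw [← Finset.prod_insert hjs] at h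
    exact hb _ (Finset.insert_nonempty j s) h
  have : IsAlgClosure L E := ⟨inferInstance, Algebra.IsAlgebraic.tower_top (K := K) L⟩
  have : Normal L E := IsAlgClosure.normal L E
  have : Algebra.IsAlgebraic L E := IsAlgClosure.isAlgebraic
  have : IsGalois L E := {}
  -- `E` is Galois over `L`, so `a j`, lying outside `L`, is moved; its square is fixed, so it can
  -- only go to `-a j`.
  have hex : ∃ σ : E ≃ₐ[L] E, σ (a j) ≠ a j := by
    by_contra! h
    obtain ⟨x, hx⟩ := mem_bot.1 ((InfiniteGalois.mem_bot_iff_fixed (k := L) (a j)).2 h)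
    exact hj (hx ▸ SetLike.coe_mem x)
  obtain ⟨σ, hσ⟩ := hex
  refine ⟨σ.restrictScalars K, ?_, fun i hi ↦ ?_⟩
  · have h : σ (a j) ^ 2 = a j ^ 2 := by
      rw [← map_pow, hab]
      exact (σ.restrictScalars K).commutes (b j)
    exact (sq_eq_sq_iff_eq_or_eq_neg.1 h).resolve_left hσ
  · exact σ.commutes ⟨a i, subset_adjoin _ _ ⟨i, by simpa using hi, rfl⟩⟩

open Polynomial in
-- A square root would be integral over `F[X]`, hence a polynomial, while a product of distinct
-- linear factors is squarefree and not a unit.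
theorem not_isSquare_prod_ratFunc {F ι : Type*} [Field F] {c : ι → F} (hc : Function.Injective c)
    {s : Finset ι} (hs : s.Nonempty) :
    ¬ IsSquare (algebraMap F[X] (RatFunc F) (∏ i ∈ s, (X - C (c i)))) := by
  rintro ⟨r, hr⟩
  obtain ⟨q, rfl⟩ := IsIntegrallyClosed.exists_algebraMap_eq_of_isIntegral_pow (R := F[X])
    (x := r) two_pos (by rw [sq, ← hr]; exact isIntegral_algebraMap)
  rw [← map_mul] at hr
  have hq : ∏ i ∈ s, (X - C (c i)) = q * q := RatFunc.algebraMap_injective F hr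
  have hsq : Squarefree (∏ i ∈ s, (X - C (c i))) :=
    (separable_prod_X_sub_C_iff'.2 fun _ _ _ _ h ↦ hc h).squarefree
  have hu : IsUnit q := hsq q (dvd_of_eq hq.symm)
  obtain ⟨i, hi⟩ := hs
  exact not_isUnit_X_sub_C (c i)
    (isUnit_of_dvd_unit (Finset.dvd_prod_of_mem (fun i ↦ X - C (c i)) hi)
      (hq ▸ hu.mul hu))

open IntermediateField Polynomial in
theorem not_isSquare_prod_adjoin_simple {F E ι : Type*} [Field F] [Field E] [Algebra F E] {t : E}
    (ht : Transcendental F t) {c : ι → F} (hc : Function.Injective c) {s : Finset ι}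
    (hs : s.Nonempty) :
    ¬ IsSquare (∏ i ∈ s, (AdjoinSimple.gen F t - algebraMap F F⟮t⟯ (c i))) := by
  intro h
  apply not_isSquare_prod_ratFunc hc hs
  have e : (RatFunc.algEquivOfTranscendental t ht).symm
      (∏ i ∈ s, (AdjoinSimple.gen F t - algebraMap F F⟮t⟯ (c i))) =
        algebraMap F[X] (RatFunc F) (∏ i ∈ s, (X - C (c i))) := by
    rw [map_prod, map_prod]
    refine Finset.prod_congr rfl fun i _ ↦ ?_
    rw [map_sub, map_sub, AlgEquiv.commutes, RatFunc.algEquivOfTranscendental_symm_gen,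
      RatFunc.algebraMap_X, RatFunc.algebraMap_C]
    rfl
  exact e ▸ h.map (RatFunc.algEquivOfTranscendental t ht).symm

open IntermediateField in
/-- Square roots `a i` of the elements `t - c i`, for `t` transcendental, are independent
as far as signs are concerned: each sign can be flipped separately. -/
theorem exists_algEquiv_neg_of_transcendental {K E ι : Type*} [Field K] [Field E] [CharZero E]
    [CharZero K] [IsAlgClosed E] [Algebra K E] [Fintype ι] {t : E} (ht : Transcendental K t)
    {c : ι → K} (hc : Function.Injective c) {a : ι → E}
    (ha : ∀ i, a i ^ 2 = t - algebraMap K E (c i)) (j : ι) :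
    ∃ σ : E ≃ₐ[K] E, σ (a j) = -a j ∧ ∀ i ≠ j, σ (a i) = a i := by
  obtain ⟨F, htF, halg⟩ := exists_transcendental_and_isAlgebraic_adjoin ht
  have hc' : Function.Injective fun i ↦ algebraMap K F (c i) := (algebraMap K F).injective.comp hc
  obtain ⟨σ, hσ⟩ := exists_algEquiv_neg_of_not_isSquare_prod (K := F⟮t⟯) (a := a)
    (b := fun i ↦ AdjoinSimple.gen F t - algebraMap F F⟮t⟯ (algebraMap K F (c i)))
    (fun i ↦ by rw [ha]; rfl) (fun s hs ↦ not_isSquare_prod_adjoin_simple htF hc' hs) j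
  exact ⟨(σ.restrictScalars F).restrictScalars K, hσ⟩

/-! ### Invariance of definable sets under automorphisms -/

open FirstOrder FirstOrder.Language

universe w

/-- Definable sets are invariant under automorphisms fixing the parameters. -/
theorem mem_iff_of_definable {L : FirstOrder.Language} {M α : Type*} [L.Structure M] {A : Set M}
    {s : Set (α → M)} (hs : A.Definable L s) (σ : M ≃[L] M) (hσ : ∀ x ∈ A, σ x = x)
    (v : α → M) : (σ ∘ v) ∈ s ↔ v ∈ s := by
  obtain ⟨φ, rfl⟩ := Set.definable_iff_exists_formula_sum.1 hs
  have h := StrongHomClass.realize_formula σ φ (v := Sum.elim (fun x : A ↦ (x : M)) v)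
  have e : σ ∘ Sum.elim (fun x : A ↦ (x : M)) v = Sum.elim (fun x : A ↦ (x : M)) (σ ∘ v) := by
    ext (x | x)
    · exact hσ x x.2
    · rfl
  rw [e] at h
  exact h

/-- `a'` looks like `a` over `A` as far as all proper subtuples are concerned. -/
def ProperSubtuplesConjugate (A : Set ℂ) {m : ℕ} (a a' : Fin m → ℂ) : Prop :=
  ∀ j : Fin m, ∃ σ : ℂ ≃+* ℂ, (∀ x ∈ A, σ x = x) ∧ ∀ l ≠ j, σ (a l) = a' l

theorem mem_iff_of_definable_ring {α : Type*} {A : Set ℂ} {s : Set (α → ℂ)}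
    (hs : A.Definable Language.ring s) (σ : ℂ ≃+* ℂ) (hσ : ∀ x ∈ A, σ x = x)
    (v : α → ℂ) : (σ ∘ v) ∈ s ↔ v ∈ s :=
  mem_iff_of_definable hs (FirstOrder.Ring.languageEquivEquivRingEquiv.symm σ) hσ v

/-- A boolean combination of cylinders over definable sets in fewer coordinates does not separate
two tuples whose proper subtuples are conjugate over a suitable finite set. -/
theorem exists_finset_forall_mem_iff_of_mem_closure {m : ℕ} {S : Set (Set (Fin m → ℂ))}
    (hS : ∀ Z ∈ S, ∃ k < m, ∃ (i : Fin k → Fin m) (C : Set (Fin k → ℂ)),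
      (Set.univ : Set ℂ).Definable Language.ring C ∧ Z = {x | (fun j ↦ x (i j)) ∈ C})
    {X : Set (Fin m → ℂ)} (hX : X ∈ BooleanSubalgebra.closure S) :
    ∃ A : Finset ℂ, ∀ a a' : Fin m → ℂ, ProperSubtuplesConjugate A a a' → (a ∈ X ↔ a' ∈ X) := by
  classical
  induction hX using BooleanSubalgebra.closure_bot_sup_induction with
  | mem Z hZ =>
    obtain ⟨k, hk, i, C, hC, rfl⟩ := hS Z hZ
    obtain ⟨A, -, hA⟩ := Set.definable_iff_finitely_definable.1 hC
    refine ⟨A, fun a a' h ↦ ?_⟩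
    have hi : ¬ Function.Surjective i := fun h ↦ by
      have := Fintype.card_le_of_surjective i h
      simp only [Fintype.card_fin] at this
      omega
    simp only [Function.Surjective, not_forall, not_exists] at hi
    obtain ⟨j, hj⟩ := hi
    obtain ⟨σ, hσA, hσ⟩ := h j
    have e : σ ∘ (fun j ↦ a (i j)) = fun j ↦ a' (i j) := funext fun l ↦ hσ _ (hj l)
    have := mem_iff_of_definable_ring hA σ hσA fun j ↦ a (i j)
    rw [e] at this
    exact this.symm
  | bot => exact ⟨∅, fun a a' _ ↦ Iff.rfl⟩
  | sup x _ y _ hx hy =>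
    obtain ⟨A, hA⟩ := hx
    obtain ⟨B, hB⟩ := hy
    refine ⟨A ∪ B, fun a a' h ↦ or_congr (hA a a' fun j ↦ ?_) (hB a a' fun j ↦ ?_)⟩
    · obtain ⟨σ, h1, h2⟩ := h j
      exact ⟨σ, fun x hx ↦ h1 x (by simp_all), h2⟩
    · obtain ⟨σ, h1, h2⟩ := h j
      exact ⟨σ, fun x hx ↦ h1 x (by simp_all), h2⟩
  | compl x _ hx =>
    obtain ⟨A, hA⟩ := hx
    exact ⟨A, fun a a' h ↦ not_congr (hA a a' h)⟩

/-! ### Model-theoretic algebraic closure -/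

/-- If the coordinate `i` determines the coordinate `j` up to two values on the set `X` defined by
`φ`, then the
`j`-th coordinate of a point of `X` in an elementary extension is algebraic over the `i`-th. -/
theorem mem_acl_of_forall_eq_or_eq {L : FirstOrder.Language} {M N : Type w} [L.Structure M]
    [L.Structure N] (f : M ↪ₑ[L] N) {B : Set M} {n : ℕ} (φ : L.Formula (B ⊕ Fin n)) {i j : Fin n}
    (hij : ∀ x y z : Fin n → M, φ.Realize (Sum.elim (fun b : B ↦ (b : M)) x) →
      φ.Realize (Sum.elim (fun b : B ↦ (b : M)) y) →
      φ.Realize (Sum.elim (fun b : B ↦ (b : M)) z) → x i = y i → x i = z i →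
      x j = y j ∨ x j = z j ∨ y j = z j)
    {a : Fin n → N} (ha : φ.Realize (Sum.elim (fun b : B ↦ f (b : M)) a)) {A : Set N}
    (hBA : f '' B ⊆ A) (hiA : a i ∈ A) : a j ∈ acl L A := by
  -- Three copies of the variables express `hij` as a first-order formula in the parameters, which
  -- transfers to `N`.
  let r (k : Fin 3) : B ⊕ Fin n → B ⊕ (Fin 3 × Fin n) := Sum.map id (Prod.mk k)
  let w (k : Fin 3) (l : Fin n) : L.Term (B ⊕ (Fin 3 × Fin n)) := Term.var (Sum.inr (k, l))
  let χ : L.Formula (B ⊕ (Fin 3 × Fin n)) :=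
    ((φ.relabel (r 0)) ⊓ (φ.relabel (r 1)) ⊓ (φ.relabel (r 2)) ⊓
      ((w 0 i).equal (w 1 i)) ⊓ ((w 0 i).equal (w 2 i))).imp
    (((w 0 j).equal (w 1 j)) ⊔ ((w 0 j).equal (w 2 j)) ⊔ ((w 1 j).equal (w 2 j)))
  have key {P : Type w} [L.Structure P] (g : B → P) :
      (χ.iAlls (Fin 3 × Fin n)).Realize g ↔
        ∀ v : Fin 3 × Fin n → P, φ.Realize (Sum.elim g fun l ↦ v (0, l)) →
          φ.Realize (Sum.elim g fun l ↦ v (1, l)) → φ.Realize (Sum.elim g fun l ↦ v (2, l)) →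
          v (0, i) = v (1, i) → v (0, i) = v (2, i) →
          v (0, j) = v (1, j) ∨ v (0, j) = v (2, j) ∨ v (1, j) = v (2, j) := by
    have hr (k : Fin 3) (v : Fin 3 × Fin n → P) :
        (fun a ↦ Sum.elim g v a) ∘ r k = Sum.elim g fun l ↦ v (k, l) := by
      ext (x | x) <;> rfl
    simp [χ, w, Formula.realize_iAlls, Formula.realize_relabel, hr, Formula.realize_equal, or_assoc]
  have hN : (χ.iAlls (Fin 3 × Fin n)).Realize (f ∘ fun b : B ↦ (b : M)) := by
    rw [f.map_formula, key]
    exact fun v h0 h1 h2 ↦ hij _ _ _ h0 h1 h2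
  rw [key] at hN
  let S : Set (Fin n → N) := {x | φ.Realize (Sum.elim (fun b : B ↦ f (b : M)) x)}
  have hS : A.Definable L S := by
    rw [Set.definable_iff_exists_formula_sum]
    refine ⟨φ.relabel (Sum.map (fun b : B ↦ (⟨f b, hBA ⟨b, b.2, rfl⟩⟩ : A)) id), ?_⟩
    ext x
    simp only [S, Set.mem_ofPred_eq, Formula.realize_relabel]
    apply iff_of_eq
    congr 1
    ext (b | l) <;> rfl
  have hT : A.Definable L {x : Fin n → N | x i = a i} :=
    (Set.Definable.singleton_of_mem L hiA).preimage_comp fun _ : Fin 1 ↦ i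
  refine ⟨(fun x ↦ x j) '' (S ∩ {x | x i = a i}), ?_, ?_, a, ⟨ha, rfl⟩, rfl⟩
  · have := (hS.inter hT).image_comp fun _ : Fin 1 ↦ j
    unfold Set.Definable₁
    convert this using 1
    ext y
    constructor
    · rintro ⟨x, hx, h⟩
      exact ⟨x, hx, funext fun l ↦ by rw [Subsingleton.elim l 0]; exact h⟩
    · rintro ⟨x, hx, h⟩
      exact ⟨x, hx, congrFun h 0⟩
  · classical
    by_contra hinf
    obtain ⟨t, ht, hcard⟩ := Set.Infinite.exists_subset_card_eq hinf 3
    obtain ⟨p, q, s, hpq, hps, hqs, rfl⟩ := Finset.card_eq_three.1 hcard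
    obtain ⟨x, hx, rfl⟩ := ht (show p ∈ _ by simp)
    obtain ⟨y, hy, rfl⟩ := ht (show q ∈ _ by simp)
    obtain ⟨z, hz, rfl⟩ := ht (show s ∈ _ by simp)
    have h := hN (fun k ↦ ![x, y, z] k.1 k.2) hx.1 hy.1 hz.1 (hx.2.trans hy.2.symm)
      (hx.2.trans hz.2.symm)
    exact h.elim hpq fun h ↦ h.elim hps hqs

theorem uncountable_complex : Uncountable ℂ :=
  Cardinal.aleph0_lt_mk_iff.1 (Cardinal.mk_complex ▸ Cardinal.aleph0_lt_continuum)

/-- The elements of a finite set definable over algebraic numbers are algebraic. -/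
theorem isAlgebraic_of_mem_acl {B : Set ℂ} (hB : ∀ x ∈ B, IsAlgebraic ℚ x) {b : ℂ}
    (hb : b ∈ acl Language.ring B) : IsAlgebraic ℚ b := by
  obtain ⟨D, hD, hfin, hbD⟩ := hb
  by_contra htr
  have htr' : Transcendental (algebraicClosure ℚ ℂ) b := Transcendental.algebraicClosure htr
  -- A transcendental `b` would bring all its translates `b + k` into `D`.
  refine Set.infinite_of_injective_forall_mem (f := fun k : ℕ ↦ b + k)
    (fun k l h ↦ by simpa using h) (fun k ↦ ?_) hfin
  obtain ⟨σ, hσ⟩ := exists_algEquiv_add_of_transcendental htr' (k : algebraicClosure ℚ ℂ)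
  have h := mem_iff_of_definable_ring hD σ.toRingEquiv
    (fun x hx ↦ σ.commutes ⟨x, mem_algebraicClosure_iff.2 (hB x hx)⟩) fun _ : Fin 1 ↦ b
  have h' : σ b ∈ D := h.2 hbD
  simpa [hσ] using h'

theorem isAlgebraic_of_mem_acl_empty {b : ℂ} (hb : b ∈ acl Language.ring (∅ : Set ℂ)) :
    IsAlgebraic ℚ b :=
  isAlgebraic_of_mem_acl (fun _ h ↦ h.elim) hb

theorem definable_setOf_lift_eq_zero {α : Type*} (A : Set ℂ) (p : FreeCommRing α) :
    A.Definable Language.ring {x : α → ℂ | FreeCommRing.lift x p = 0} := by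
  refine Set.Definable.mono (Set.empty_definable_iff.2
    ⟨(FirstOrder.Ring.termOfFreeCommRing p).equal (FirstOrder.Ring.termOfFreeCommRing 0), ?_⟩)
    (Set.empty_subset A)
  ext x
  simp [Formula.realize_equal, FirstOrder.Ring.realize_termOfFreeCommRing]

/-! ### The curve of square roots and its dimension -/

/-- The curve `x₀² = x₁² + 1 = ⋯ = xₙ₋₁² + (n - 1)`, `xₙ = x₀ ⋯ xₙ₋₁`. -/
def squareRootsCurve (n : ℕ) : Set (Fin (n + 1) → ℂ) :=
  {x | (∀ i j : Fin n, x i.castSucc ^ 2 + (i : ℕ) = x j.castSucc ^ 2 + (j : ℕ)) ∧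
    x (Fin.last n) = ∏ i : Fin n, x i.castSucc}

theorem definable_squareRootsCurve (n : ℕ) (A : Set ℂ) :
    A.Definable Language.ring (squareRootsCurve n) := by
  let X (i : Fin (n + 1)) : FreeCommRing (Fin (n + 1)) := FreeCommRing.of i
  have h1 := Set.definable_iInter_of_finite fun p : Fin n × Fin n ↦ definable_setOf_lift_eq_zero A
    (X p.1.castSucc ^ 2 + ((p.1 : ℕ) : FreeCommRing _) -
      (X p.2.castSucc ^ 2 + ((p.2 : ℕ) : FreeCommRing _)))
  have h2 := definable_setOf_lift_eq_zero A (X (Fin.last n) - ∏ i : Fin n, X i.castSucc)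
  convert h1.inter h2 using 1
  ext x
  simp [squareRootsCurve, X, sub_eq_zero, map_prod]

/-- One square root determines `t`, hence the squares of all the others and of their product. -/
theorem sq_eq_sq_of_mem_squareRootsCurve {n : ℕ} {x y : Fin (n + 1) → ℂ}
    (hx : x ∈ squareRootsCurve n) (hy : y ∈ squareRootsCurve n) {i : Fin n}
    (h : x i.castSucc = y i.castSucc) (j : Fin (n + 1)) : x j ^ 2 = y j ^ 2 := by
  have key (l : Fin n) : x l.castSucc ^ 2 = y l.castSucc ^ 2 := by
    linear_combination hy.1 i l - hx.1 i l + (x i.castSucc + y i.castSucc) * h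
  induction j using Fin.lastCases with
  | last =>
    rw [hx.2, hy.2, ← Finset.prod_pow, ← Finset.prod_pow]
    exact Finset.prod_congr rfl fun l _ ↦ key l
  | cast l => exact key l

theorem exists_mem_squareRootsCurve (n : ℕ) (t : ℂ) :
    ∃ x ∈ squareRootsCurve n, ∀ i : Fin n, x i.castSucc ^ 2 = t - (i : ℕ) := by
  choose a ha using fun i : Fin n ↦ IsAlgClosed.exists_pow_nat_eq (t - (i : ℕ)) two_pos
  refine ⟨Fin.snoc (α := fun _ ↦ ℂ) a (∏ i, a i), ⟨fun i j ↦ ?_, ?_⟩, fun i ↦ ?_⟩ <;> simp [ha]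

theorem hasIndependentSubtuple_squareRootsCurve {n : ℕ} (hn : 0 < n) :
    HasIndependentSubtuple Language.ring (acl Language.ring (∅ : Set ℂ)) (squareRootsCurve n)
      1 := by
  obtain ⟨φ, hφ⟩ := Set.definable_iff_exists_formula_sum.1
    (definable_squareRootsCurve n (acl Language.ring (∅ : Set ℂ)))
  have := uncountable_complex
  obtain ⟨t, ht⟩ := exists_transcendental_subfieldClosure (E := ℂ) Set.countable_empty
  have ht' : Transcendental ℚ t := fun h ↦ ht (h.tower_top _)
  obtain ⟨x, hx, hxt⟩ := exists_mem_squareRootsCurve n t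
  refine ⟨φ, hφ, ℂ, inferInstance, ElementaryEmbedding.refl _ _, x, ?_,
    OrderEmbedding.ofStrictMono (fun _ ↦ 0) (fun i j h ↦ by omega), fun j h ↦ ht' ?_⟩
  · rw [hφ] at hx
    exact hx
  have halg : IsAlgebraic ℚ (x 0) := by
    refine isAlgebraic_of_mem_acl (fun y hy ↦ ?_) h
    rcases hy with ⟨y, hy, rfl⟩ | ⟨k, hk, -⟩
    · exact isAlgebraic_of_mem_acl_empty hy
    · exact absurd (Subsingleton.elim k j) (ne_of_lt hk)
  have : t = x 0 ^ 2 := by simpa using (hxt ⟨0, hn⟩).symm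
  rw [this]
  exact halg.pow 2

theorem le_one_of_hasIndependentSubtuple_squareRootsCurve {n d : ℕ} {B : Set ℂ}
    (h : HasIndependentSubtuple Language.ring B (squareRootsCurve n) d) : d ≤ 1 := by
  by_contra! hd
  obtain ⟨φ, hφ, N, _, f, a, ha, i, hi⟩ := h
  have hlt : i ⟨0, by omega⟩ < i ⟨1, hd⟩ := i.strictMono (by simp [Fin.lt_def])
  -- Subtuples are increasing, so the earlier of two entries is never the last coordinate: it is one
  -- of the square roots.
  obtain ⟨l, hl⟩ : ∃ l : Fin n, l.castSucc = i ⟨0, by omega⟩ :=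
    Fin.exists_castSucc_eq.2 (ne_of_lt (hlt.trans_le (Fin.le_last _)))
  have hmem {x : Fin (n + 1) → ℂ} (hx : φ.Realize (Sum.elim (fun b : B ↦ (b : ℂ)) x)) :
      x ∈ squareRootsCurve n := by
    rw [hφ]
    exact hx
  refine hi ⟨1, hd⟩ (mem_acl_of_forall_eq_or_eq f φ (i := i ⟨0, by omega⟩)
    (fun x y z hx hy hz hxy hxz ↦ ?_) ha Set.subset_union_left (Or.inr ⟨⟨0, by omega⟩, ?_, rfl⟩))
  · rw [← hl] at hxy hxz
    have h1 := sq_eq_sq_of_mem_squareRootsCurve (hmem hx) (hmem hy) hxy (i ⟨1, hd⟩)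
    have h2 := sq_eq_sq_of_mem_squareRootsCurve (hmem hx) (hmem hz) hxz (i ⟨1, hd⟩)
    rcases sq_eq_sq_iff_eq_or_eq_neg.1 h1 with h1 | h1
    · exact Or.inl h1
    rcases sq_eq_sq_iff_eq_or_eq_neg.1 h2 with h2 | h2
    · exact Or.inr (Or.inl h2)
    · exact Or.inr (Or.inr (neg_injective (h1.symm.trans h2)))
  · simp [Fin.lt_def]

theorem aclDim_squareRootsCurve {n : ℕ} (hn : 0 < n) :
    aclDim Language.ring (acl Language.ring (∅ : Set ℂ)) (squareRootsCurve n) = 1 := by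
  apply le_antisymm
  · refine iSup₂_le fun d hd ↦ ?_
    have := le_one_of_hasIndependentSubtuple_squareRootsCurve hd
    exact_mod_cast this
  · exact le_iSup₂_of_le 1 (hasIndependentSubtuple_squareRootsCurve hn) le_rfl

/-- Over any finite set there is a point of the curve such that changing the sign of its last
coordinate affects the type of the whole tuple, but of no proper subtuple. -/
theorem exists_properSubtuplesConjugate_squareRootsCurve (n : ℕ) (A : Finset ℂ) :
    ∃ a ∈ squareRootsCurve n, ∃ a' ∉ squareRootsCurve n, ProperSubtuplesConjugate A a a' := by
  have := uncountable_complex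
  obtain ⟨t, ht⟩ := exists_transcendental_subfieldClosure (E := ℂ) A.countable_toSet
  obtain ⟨x, hx, hxt⟩ := exists_mem_squareRootsCurve n t
  have hne (i : Fin n) : x i.castSucc ≠ 0 := by
    intro h
    apply ht
    have e : t = ((i : ℕ) : ℂ) := by
      have := hxt i
      rw [h] at this
      linear_combination -this
    rw [e]
    exact isAlgebraic_natCast (R := Subfield.closure (A : Set ℂ)) (A := ℂ) (i : ℕ)
  have hlast : x (Fin.last n) ≠ 0 := hx.2 ▸ Finset.prod_ne_zero_iff.2 fun i _ ↦ hne i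
  -- Since `x_n ≠ 0`, the sign change breaks the product equation.
  refine ⟨x, hx, Function.update x (Fin.last n) (-x (Fin.last n)), ?_, fun j ↦ ?_⟩
  · rintro ⟨-, h⟩
    simp only [Function.update_self, Function.update_of_ne (Fin.castSucc_ne_last _), ← hx.2] at h
    exact hlast (by linear_combination -h / 2)
  induction j using Fin.lastCases with
  | last => exact ⟨RingEquiv.refl ℂ, fun _ _ ↦ rfl, fun l hl ↦ (Function.update_of_ne hl _ _).symm⟩
  | cast j =>
    obtain ⟨σ, hj, hσ⟩ := exists_algEquiv_neg_of_transcendental ht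
      (c := fun i : Fin n ↦ ((i : ℕ) : Subfield.closure (A : Set ℂ)))
      (fun i j h ↦ Fin.ext (Nat.cast_injective h)) (a := fun i ↦ x i.castSucc)
      (fun i ↦ by simp [hxt]) j
    refine ⟨σ.toRingEquiv, fun y hy ↦ σ.commutes ⟨y, Subfield.subset_closure hy⟩, fun l hl ↦ ?_⟩
    induction l using Fin.lastCases with
    | last =>
      change σ _ = _
      rw [Function.update_self, hx.2, map_prod, ← Finset.mul_prod_erase _ _ (Finset.mem_univ j),
        ← Finset.mul_prod_erase _ (fun i : Fin n ↦ x i.castSucc) (Finset.mem_univ j), hj, neg_mul]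
      congr 2
      exact Finset.prod_congr rfl fun i hi ↦ hσ i (Finset.ne_of_mem_erase hi)
    | cast l =>
      rw [Function.update_of_ne (Fin.castSucc_ne_last l)]
      exact hσ l fun h ↦ hl (h ▸ rfl)

end CurveCylinders

theorem corollary5p2 (n : ℕ) (hn : 2 ≤ n) :
    ∃ X : Set (Fin (n + 1) → ℂ),
      (CurveCylinders.acl FirstOrder.Language.ring (∅ : Set ℂ)).Definable
        FirstOrder.Language.ring X ∧
      CurveCylinders.aclDim FirstOrder.Language.ring
        (CurveCylinders.acl FirstOrder.Language.ring (∅ : Set ℂ)) X = 1 ∧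
      X ∉ BooleanSubalgebra.closure
        {Z : Set (Fin (n + 1) → ℂ) | ∃ k : ℕ, k ≤ max 2 (n - 1) ∧
          CurveCylinders.IsCylinderOnCurve FirstOrder.Language.ring (Set.univ : Set ℂ) k Z} := by
  refine ⟨CurveCylinders.squareRootsCurve n, CurveCylinders.definable_squareRootsCurve n _,
    CurveCylinders.aclDim_squareRootsCurve (by omega), fun hX ↦ ?_⟩
  obtain ⟨A, hA⟩ := CurveCylinders.exists_finset_forall_mem_iff_of_mem_closure (by
    -- As `n ≥ 2`, `max 2 (n - 1) < n + 1`, so every cylinder ignores a coordinate.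
    rintro Z ⟨k, hk, i, C, hC, rfl⟩
    exact ⟨k, by omega, i, C, hC.1, rfl⟩) hX
  obtain ⟨a, ha, a', ha', h⟩ :=
    CurveCylinders.exists_properSubtuplesConjugate_squareRootsCurve n A
  exact ha' ((hA a a' h).1 ha)
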